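/- Let $d\ge 1$, let $\mu\in\mathbb{R}^d$, let $\Sigma\in\mathbb{R}^{d\times d}$ be symmetric positive definite, and let $\mathbf{x}\sim\mathcal N(\mu,\Sigma)$ be a Gaussian random vector. Then $\mathbf{x}$ has the density $$p(x)=\big((2\pi)^d\det\Sigma\big)^{-1/2}\exp\!\big(-\tfrac12 (x-\mu)^\top\Sigma^{-1}(x-\mu)\big).$$ For $S\subseteq\{1,\dots,d\}$ with complement $\bar S$, write $x=(x_S,x_{\bar S})$ and let $$p(x_{\bar S}\mid x_S)=\frac{p(x_S,x_{\bar S})}{\int p(x_S,y)\,dy},$$ the integral being over $y\in\mathbb{R}^{|\bar S|}$, be the conditional density of the features outside $S$ given the value $x_S$ of those in $S$; it is a probability density for every $S$ and every $x_S\in\mathbb{R}^{|S|}$. Let $$d_{TV}\big(p(\cdot\mid x_S),p(\cdot\mid x_S')\big)=\frac12\int\big|p(y\mid x_S)-p(y\mid x_S')\big|\,dy .$$ Then, with $$M=\frac12\sqrt{\lambda_{\max}(\Sigma^{-1})-\lambda_{\min}(\Sigma^{-1})},$$ where $\lambda_{\max}$ and $\lambda_{\min}$ denote the largest and the smallest eigenvalue,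 one has, for all $S\subseteq\{1,\dots,d\}$, $$d_{TV}\big(p(\cdot\mid x_S),p(\cdot\mid x_S')\big)\le M\,\lVert x_S-x_S'\rVert_2\qquad\text{for all }x_S,x_S'\in\mathbb{R}^{|S|}.$$ -/

import Mathlib

open MeasureTheory ProbabilityTheory Matrix
open scoped ENNReal

namespace RemovalAttribution

noncomputable section

/-- The density of the nondegenerate Gaussian law on `ℝ^d` with mean `m` and covariance `C`:
`((2π)^d det C)^(-1/2) exp (-(1/2) (x - m)ᵀ C⁻¹ (x - m))`. -/
def gaussianDensity {d : ℕ} (m : EuclideanSpace ℝ (Fin d)) (C : Matrix (Fin d) (Fin d) ℝ)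
    (x : EuclideanSpace ℝ (Fin d)) : ℝ :=
  (√((2 * Real.pi) ^ d * C.det))⁻¹ *
    Real.exp (-(1 / 2) * ((x - m).ofLp ⬝ᵥ (C⁻¹ *ᵥ (x - m).ofLp)))

/-- The point of `ℝ^d` with coordinates `xS` in `S` and `y` outside `S`. -/
def combine {d : ℕ} (S : Finset (Fin d)) (xS : EuclideanSpace ℝ {i // i ∈ S})
    (y : EuclideanSpace ℝ {i // i ∉ S}) : EuclideanSpace ℝ (Fin d) :=
  WithLp.toLp 2 (fun i => if h : i ∈ S then xS ⟨i, h⟩ else y ⟨i, h⟩)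

/-- The marginal density `p(x_S) = ∫ p(x_S, y) dy`. -/
def marginalDensity {d : ℕ} (p : EuclideanSpace ℝ (Fin d) → ℝ) (S : Finset (Fin d))
    (xS : EuclideanSpace ℝ {i // i ∈ S}) : ℝ :=
  ∫ y : EuclideanSpace ℝ {i // i ∉ S}, p (combine S xS y)

/-- The conditional density `y ↦ p(y | x_S) = p(x_S, y) / p(x_S)` of the features outside `S`. -/
def condDensity {d : ℕ} (p : EuclideanSpace ℝ (Fin d) → ℝ) (S : Finset (Fin d))
    (xS : EuclideanSpace ℝ {i // i ∈ S}) (y : EuclideanSpace ℝ {i // i ∉ S}) : ℝ :=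
  p (combine S xS y) / marginalDensity p S xS

/-- The total variation distance of two densities, as half of their `L¹` distance. -/
def tvDist {E : Type*} [MeasureSpace E] (f g : E → ℝ) : ℝ≥0∞ :=
  2⁻¹ * eLpNorm (fun y => f y - g y) 1 volume

/-- The conditional distributions of the density `p` are Lipschitz in total variation with
constant `M`, for every feature set `S` and all observed values (and they are genuine
probability densities, so that no convention about division by zero or about divergent
integrals enters). -/
structure TVLipschitz {d : ℕ} (p : EuclideanSpace ℝ (Fin d) → ℝ) (M : ℝ) : Prop where
  nonneg_const : 0 ≤ M
  nonneg_cond : ∀ (S : Finset (Fin d)) (xS : EuclideanSpace ℝ {i // i ∈ S})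
    (y : EuclideanSpace ℝ {i // i ∉ S}), 0 ≤ condDensity p S xS y
  isProbabilityMeasure_cond : ∀ (S : Finset (Fin d)) (xS : EuclideanSpace ℝ {i // i ∈ S}),
    IsProbabilityMeasure
      ((volume : Measure (EuclideanSpace ℝ {i // i ∉ S})).withDensity
        (fun y => ENNReal.ofReal (condDensity p S xS y)))
  tvDist_le : ∀ (S : Finset (Fin d)) (xS xS' : EuclideanSpace ℝ {i // i ∈ S}),
    tvDist (condDensity p S xS) (condDensity p S xS') ≤ ENNReal.ofReal (M * ‖xS - xS'‖)

/-- The largest eigenvalue of a real symmetric matrix. -/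
def lambdaMax {d : ℕ} (A : Matrix (Fin d) (Fin d) ℝ) : ℝ := sSup (spectrum ℝ A)

/-- The smallest eigenvalue of a real symmetric matrix. -/
def lambdaMin {d : ℕ} (A : Matrix (Fin d) (Fin d) ℝ) : ℝ := sInf (spectrum ℝ A)

end

end RemovalAttribution

/-! Put A = C⁻¹, q(u) = uᵀAu, and write the two observed values as c ± h. Multiplying Gaussian
densities at symmetric points cancels the linear terms, so p(c+h,y) p(c-h,y) = p(c,y)² exp(-q(h,0)).
For the marginals, shift instead by (h,w), where w makes (h,w) A-orthogonal to all vectors supported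
outside S (`exists_combine_orthogonal`); by `marginalDensity_add` their product is p(c)²
exp(-q(h,w)).

Hence the geometric mean of the two conditional densities is a constant times p(y|c), and their
Hellinger affinity is exactly exp(-(q(h,0) - q(h,w))/2). As q(h,0) ≤ λmax‖h‖² and q(h,w) ≥ λmin‖h‖²,
it is at least 1 - (λmax - λmin)‖h‖²/2, which `tvDist_le_of_affinity` turns into the bound.

The density formula is independent: characteristic functions settle the standard Gaussian, and an
affine change of variables the rest. -/

namespace RemovalAttribution

/-! ### Total variation and Hellinger affinity -/

/-- A lower bound on the Hellinger affinity of two densities bounds their total variation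
distance. -/
theorem tvDist_le_of_affinity {E : Type*} [MeasureSpace E] {f g h : E → ℝ} {s : ℝ}
    (hs : 0 ≤ s) (hf : Integrable f) (hg : Integrable g) (hh : Integrable h)
    (hf0 : ∀ y, 0 ≤ f y) (hg0 : ∀ y, 0 ≤ g y) (hfg : ∀ y, h y ^ 2 = f y * g y)
    (hf1 : ∫ y, f y = 1) (hg1 : ∫ y, g y = 1) (hh1 : 1 - s ^ 2 / 8 ≤ ∫ y, h y) :
    tvDist f g ≤ ENNReal.ofReal (s / 2) := by
  have key : ∀ s : ℝ, 0 < s → 1 - s ^ 2 / 8 ≤ ∫ y, h y → ∫ y, |f y - g y| ≤ s := by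
    intro s hs hh1
    -- With u = f + g - 2h and v = f + g, (f - g)² = u(2v - u) ≤ 2uv; AM-GM with weight s replaces
    -- Cauchy-Schwarz. The weights make the integrated bound exactly s.
    have hpt : ∀ y, |f y - g y| ≤ 2 / s * (f y + g y - 2 * h y) + s / 4 * (f y + g y) := by
      intro y
      have hf := hf0 y
      have hg := hg0 y
      have hh := hfg y
      have hu : 0 ≤ f y + g y - 2 * h y := by
        have : |2 * h y| ≤ f y + g y :=
          abs_le_of_sq_le_sq (by nlinarith [sq_nonneg (f y - g y)]) (by positivity)
        linarith [le_abs_self (2 * h y)]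
      refine abs_le_of_sq_le_sq ?_ (by positivity)
      have e : (2 / s * (f y + g y - 2 * h y) + s / 4 * (f y + g y)) ^ 2 =
          (2 / s * (f y + g y - 2 * h y) - s / 4 * (f y + g y)) ^ 2 +
            2 * (f y + g y - 2 * h y) * (f y + g y) := by field_simp; ring
      rw [e]
      nlinarith [sq_nonneg (2 / s * (f y + g y - 2 * h y) - s / 4 * (f y + g y)),
        sq_nonneg (f y + g y - 2 * h y)]
    have hi : Integrable (fun y => 2 / s * (f y + g y - 2 * h y) + s / 4 * (f y + g y)) :=
      (((hf.add hg).sub (hh.const_mul 2)).const_mul _).add ((hf.add hg).const_mul _)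
    calc ∫ y, |f y - g y| ≤ ∫ y, (2 / s * (f y + g y - 2 * h y) + s / 4 * (f y + g y)) :=
          integral_mono (hf.sub hg).abs hi hpt
      _ = 2 / s * (2 - 2 * ∫ y, h y) + s / 4 * 2 := by
          have h1 : Integrable fun y => f y + g y := hf.add hg
          have h2 : Integrable fun y => f y + g y - 2 * h y := h1.sub (hh.const_mul 2)
          rw [integral_add (h2.const_mul _) (h1.const_mul _), integral_const_mul,
            integral_const_mul, integral_sub h1 (hh.const_mul 2), integral_const_mul,
            integral_add hf hg, hf1, hg1]
          norm_num
      _ ≤ 2 / s * (2 - 2 * (1 - s ^ 2 / 8)) + s / 4 * 2 := by gcongr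
      _ = s := by field_simp; ring
  have hle : ∫ y, |f y - g y| ≤ s := by
    -- The weight 2/s needs s > 0; the case s = 0 follows by letting ε tend to 0.
    refine le_of_forall_pos_le_add fun ε hε => key (s + ε) (by positivity) (le_trans ?_ hh1)
    nlinarith
  rw [tvDist, eLpNorm_one_eq_lintegral_enorm]
  have : ∫⁻ y, ‖f y - g y‖ₑ = ENNReal.ofReal (∫ y, |f y - g y|) := by
    have h1 : Integrable fun y => f y - g y := hf.sub hg
    rw [← ofReal_integral_norm_eq_lintegral_enorm h1]
    rfl
  rw [this, ← ENNReal.ofReal_ofNat 2, ← ENNReal.ofReal_inv_of_pos two_pos,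
    ← ENNReal.ofReal_mul (by norm_num)]
  exact ENNReal.ofReal_le_ofReal (by linarith)

/-! ### Quadratic forms and extreme eigenvalues -/

theorem dotProduct_mulVec_le_lambdaMax {d : ℕ} {A : Matrix (Fin d) (Fin d) ℝ}
    (hA : A.IsHermitian) (u : EuclideanSpace ℝ (Fin d)) :
    u.ofLp ⬝ᵥ (A *ᵥ u.ofLp) ≤ lambdaMax A * ‖u‖ ^ 2 := by
  have h : (algebraMap ℝ (Matrix (Fin d) (Fin d) ℝ) (lambdaMax A) - A).PosSemidef := by
    rw [posSemidef_iff_isHermitian_and_spectrum_nonneg, ← spectrum.singleton_sub_eq]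
    refine ⟨?_, ?_⟩
    · rw [Algebra.algebraMap_eq_smul_one]
      exact (isHermitian_one.smul (by simp [IsSelfAdjoint])).sub hA
    · rintro _ ⟨_, rfl, x, hx, rfl⟩
      exact sub_nonneg.2 (le_csSup A.finite_real_spectrum.bddAbove hx)
  have := h.dotProduct_mulVec_nonneg u.ofLp
  rw [Algebra.algebraMap_eq_smul_one, sub_mulVec, smul_mulVec, one_mulVec, dotProduct_sub,
    dotProduct_smul, star_trivial] at this
  have e : u.ofLp ⬝ᵥ u.ofLp = ‖u‖ ^ 2 := by
    rw [EuclideanSpace.real_norm_sq_eq]; simp [dotProduct, sq]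
  rw [e, smul_eq_mul] at this
  linarith

theorem mul_norm_sq_le_dotProduct_mulVec {d : ℕ} {A : Matrix (Fin d) (Fin d) ℝ}
    (hA : A.IsHermitian) {k : ℝ} (hk : ∀ x ∈ spectrum ℝ A, k ≤ x)
    (u : EuclideanSpace ℝ (Fin d)) :
    k * ‖u‖ ^ 2 ≤ u.ofLp ⬝ᵥ (A *ᵥ u.ofLp) := by
  have h : (A - algebraMap ℝ (Matrix (Fin d) (Fin d) ℝ) k).PosSemidef := by
    rw [posSemidef_iff_isHermitian_and_spectrum_nonneg, ← spectrum.sub_singleton_eq]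
    refine ⟨?_, ?_⟩
    · rw [Algebra.algebraMap_eq_smul_one]
      exact hA.sub (isHermitian_one.smul (by simp [IsSelfAdjoint]))
    · rintro _ ⟨x, hx, _, rfl, rfl⟩
      exact sub_nonneg.2 (hk x hx)
  have := h.dotProduct_mulVec_nonneg u.ofLp
  rw [Algebra.algebraMap_eq_smul_one, sub_mulVec, smul_mulVec, one_mulVec, dotProduct_sub,
    dotProduct_smul, star_trivial] at this
  have e : u.ofLp ⬝ᵥ u.ofLp = ‖u‖ ^ 2 := by
    rw [EuclideanSpace.real_norm_sq_eq]; simp [dotProduct, sq]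
  rw [e, smul_eq_mul] at this
  linarith

theorem lambdaMin_mul_norm_sq_le {d : ℕ} {A : Matrix (Fin d) (Fin d) ℝ}
    (hA : A.IsHermitian) (u : EuclideanSpace ℝ (Fin d)) :
    lambdaMin A * ‖u‖ ^ 2 ≤ u.ofLp ⬝ᵥ (A *ᵥ u.ofLp) :=
  mul_norm_sq_le_dotProduct_mulVec hA
    (fun _ hx => csInf_le A.finite_real_spectrum.bddBelow hx) u

theorem spectrum_pos {d : ℕ} {A : Matrix (Fin d) (Fin d) ℝ} (hA : A.PosDef) {x : ℝ}
    (hx : x ∈ spectrum ℝ A) : 0 < x := by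
  rw [hA.isHermitian.spectrum_real_eq_range_eigenvalues] at hx
  obtain ⟨i, rfl⟩ := hx
  exact hA.eigenvalues_pos i

theorem lambdaMin_nonneg {d : ℕ} {A : Matrix (Fin d) (Fin d) ℝ} (hA : A.PosDef) :
    0 ≤ lambdaMin A :=
  Real.sInf_nonneg fun _ hx => (spectrum_pos hA hx).le

theorem exists_pos_mul_norm_sq_le {d : ℕ} {A : Matrix (Fin d) (Fin d) ℝ} (hA : A.PosDef) :
    ∃ k : ℝ, 0 < k ∧ ∀ u : EuclideanSpace ℝ (Fin d), k * ‖u‖ ^ 2 ≤ u.ofLp ⬝ᵥ (A *ᵥ u.ofLp) := by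
  obtain ⟨k, hk, hkA⟩ : ∃ k : ℝ, 0 < k ∧ ∀ x ∈ spectrum ℝ A, k ≤ x := by
    rcases (spectrum ℝ A).eq_empty_or_nonempty with h | h
    -- The spectrum is empty when d = 0, where `lambdaMin` is 0 and cannot serve as k.
    · exact ⟨1, one_pos, by simp [h]⟩
    · exact ⟨sInf (spectrum ℝ A), spectrum_pos hA (h.csInf_mem A.finite_real_spectrum),
        fun _ hx => csInf_le A.finite_real_spectrum.bddBelow hx⟩
  exact ⟨k, hk, mul_norm_sq_le_dotProduct_mulVec hA.isHermitian hkA⟩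

/-! ### Splitting coordinates along S -/

section combine

variable {d : ℕ} (S : Finset (Fin d))

theorem combine_add (a b : EuclideanSpace ℝ {i // i ∈ S}) (y z : EuclideanSpace ℝ {i // i ∉ S}) :
    combine S (a + b) (y + z) = combine S a y + combine S b z := by
  ext i
  by_cases h : i ∈ S <;> simp [combine, h]

theorem combine_smul (r : ℝ) (a : EuclideanSpace ℝ {i // i ∈ S})
    (y : EuclideanSpace ℝ {i // i ∉ S}) : combine S (r • a) (r • y) = r • combine S a y := by
  ext i
  by_cases h : i ∈ S <;> simp [combine, h]

theorem dotProduct_combine (u : EuclideanSpace ℝ (Fin d)) (a : EuclideanSpace ℝ {i // i ∈ S})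
    (y : EuclideanSpace ℝ {i // i ∉ S}) :
    u.ofLp ⬝ᵥ (combine S a y).ofLp =
      (∑ i : {i // i ∈ S}, u i * a i) + ∑ i : {i // i ∉ S}, u i * y i := by
  have e1 : ∑ i : {i // i ∈ S}, u i * a i = ∑ i : {i // i ∈ S}, u i * combine S a y i :=
    Fintype.sum_congr _ _ fun i => by simp [combine]
  have e2 : ∑ i : {i // i ∉ S}, u i * y i = ∑ i : {i // i ∉ S}, u i * combine S a y i :=
    Fintype.sum_congr _ _ fun i => by
      have := i.2
      simp [combine, this]
  rw [e1, e2, dotProduct]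
  convert (Fintype.sum_subtype_add_sum_subtype (fun i => i ∈ S)
    fun i => u i * combine S a y i).symm

theorem norm_combine_sq (a : EuclideanSpace ℝ {i // i ∈ S})
    (y : EuclideanSpace ℝ {i // i ∉ S}) : ‖combine S a y‖ ^ 2 = ‖a‖ ^ 2 + ‖y‖ ^ 2 := by
  have h := dotProduct_combine S (combine S a y) a y
  simp only [EuclideanSpace.real_norm_sq_eq]
  rw [dotProduct] at h
  simp only [sq]
  rw [h]
  congr 1
  · refine Fintype.sum_congr _ _ fun i => ?_
    have := i.2
    simp [combine, this]
  · refine Fintype.sum_congr _ _ fun i => ?_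
    have := i.2
    simp [combine, this]

theorem continuous_combine (a : EuclideanSpace ℝ {i // i ∈ S}) : Continuous (combine S a) := by
  refine (PiLp.continuous_toLp 2 _).comp (continuous_pi fun i => ?_)
  by_cases h : i ∈ S
  · simpa [h] using continuous_const
  · simp only [h, dite_false]; fun_prop

/-- For every value of the coordinates in `S`, the other coordinates can be chosen so that the
point is orthogonal, for a positive definite form, to all vectors supported outside `S`. -/
theorem exists_combine_orthogonal {A : Matrix (Fin d) (Fin d) ℝ} (hA : A.PosDef)
    (v : EuclideanSpace ℝ {i // i ∈ S}) :
    ∃ w : EuclideanSpace ℝ {i // i ∉ S}, ∀ y : EuclideanSpace ℝ {i // i ∉ S},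
      (A *ᵥ (combine S v w).ofLp) ⬝ᵥ (combine S 0 y).ofLp = 0 := by
  have hc : ∀ r a y, combine S r (a + y) = combine S r a + combine S 0 y := fun r a y => by
    rw [← combine_add, add_zero]
  -- L is the diagonal block of A outside S. It inherits definiteness, so it is invertible and w =
  -- -L⁻¹ applied to the outside coordinates of A(v,0).
  let L : EuclideanSpace ℝ {i // i ∉ S} →ₗ[ℝ] EuclideanSpace ℝ {i // i ∉ S} :=
    { toFun := fun y => WithLp.toLp 2 fun i => (A *ᵥ (combine S 0 y).ofLp) i
      map_add' := fun y z => by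
        ext i
        simp [hc, mulVec_add]
      map_smul' := fun r y => by
        ext i
        have := combine_smul S r 0 y
        rw [smul_zero] at this
        simp [this, mulVec_smul] }
  have hL : ∀ y i, L y i = (A *ᵥ (combine S 0 y).ofLp) i := fun _ _ => rfl
  have hinj : Function.Injective L := by
    rw [injective_iff_map_eq_zero]
    intro y hy
    have h1 : (A *ᵥ (combine S 0 y).ofLp) ⬝ᵥ (combine S 0 y).ofLp = 0 := by
      have := dotProduct_combine S (WithLp.toLp 2 (A *ᵥ (combine S 0 y).ofLp)) 0 y
      simp only at this
      rw [this]
      simp [← hL, hy]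
    obtain ⟨k, hk, hkA⟩ := exists_pos_mul_norm_sq_le hA
    have h2 := hkA (combine S 0 y)
    rw [dotProduct_comm, h1, norm_combine_sq] at h2
    have : ‖y‖ ^ 2 ≤ 0 := by
      simp at h2
      nlinarith
    simpa using this
  obtain ⟨w, hw⟩ := LinearMap.injective_iff_surjective.1 hinj
    (-WithLp.toLp 2 fun i : {i // i ∉ S} => (A *ᵥ (combine S v 0).ofLp) i)
  refine ⟨w, fun y => ?_⟩
  have := dotProduct_combine S (WithLp.toLp 2 (A *ᵥ (combine S v w).ofLp)) 0 y
  simp only at this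
  rw [this]
  have h0 : ∀ i : {i // i ∉ S}, (A *ᵥ (combine S v w).ofLp) i = 0 := fun i => by
    have h1 : L w i = _ := congrArg (fun z : EuclideanSpace ℝ {i // i ∉ S} => z i) hw
    rw [hL] at h1
    have h2 := hc v 0 w
    rw [zero_add] at h2
    rw [h2, WithLp.ofLp_add, mulVec_add, Pi.add_apply, h1]
    simp
  simp [h0]

end combine

/-! ### Gaussian conditional densities -/

section conditional

variable {d : ℕ} {m : EuclideanSpace ℝ (Fin d)} {C : Matrix (Fin d) (Fin d) ℝ}

theorem gaussianDensity_pos (hC : C.PosDef) (x : EuclideanSpace ℝ (Fin d)) :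
    0 < gaussianDensity m C x := by
  have := hC.det_pos
  unfold gaussianDensity
  positivity

theorem continuous_gaussianDensity : Continuous (gaussianDensity m C) := by
  unfold gaussianDensity
  fun_prop

theorem gaussianDensity_add (hC : C.PosDef) (x z : EuclideanSpace ℝ (Fin d)) :
    gaussianDensity m C (x + z) = gaussianDensity m C x *
      Real.exp (-((C⁻¹ *ᵥ z.ofLp) ⬝ᵥ (x - m).ofLp) - z.ofLp ⬝ᵥ (C⁻¹ *ᵥ z.ofLp) / 2) := by
  have hsymm : z.ofLp ⬝ᵥ (C⁻¹ *ᵥ (x - m).ofLp) = (C⁻¹ *ᵥ z.ofLp) ⬝ᵥ (x - m).ofLp := by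
    have h : C⁻¹ᵀ = C⁻¹ := by simpa [IsHermitian] using hC.inv.isHermitian
    rw [dotProduct_mulVec, ← mulVec_transpose, h]
  unfold gaussianDensity
  rw [mul_assoc, ← Real.exp_add, show x + z - m = (x - m) + z by abel, WithLp.ofLp_add, mulVec_add,
    dotProduct_add, add_dotProduct, add_dotProduct, hsymm, dotProduct_comm (x - m).ofLp (C⁻¹ *ᵥ z.ofLp)]
  congr 2
  ring

theorem integrable_exp_neg_mul_norm_sq {V : Type*} [NormedAddCommGroup V] [InnerProductSpace ℝ V]
    [FiniteDimensional ℝ V] [MeasurableSpace V] [BorelSpace V] {b : ℝ} (hb : 0 < b) :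
    Integrable fun v : V => Real.exp (-b * ‖v‖ ^ 2) := by
  convert (GaussianFourier.integrable_cexp_neg_mul_sq_norm_add (V := V) (b := b)
    (by simpa using hb) 0 0).norm using 2 with v
  rw [Complex.norm_exp]
  norm_cast
  simp

variable (S : Finset (Fin d))

theorem integrable_gaussianDensity_combine (hC : C.PosDef)
    (a : EuclideanSpace ℝ {i // i ∈ S}) :
    Integrable fun y => gaussianDensity m C (combine S a y) := by
  obtain ⟨k, hk, hkC⟩ := exists_pos_mul_norm_sq_le hC.inv
  set mT : EuclideanSpace ℝ {i // i ∉ S} := WithLp.toLp 2 fun i => m i with hmT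
  have hi := ((integrable_exp_neg_mul_norm_sq (half_pos hk)).comp_sub_right mT).const_mul
    (√((2 * Real.pi) ^ d * C.det))⁻¹
  refine hi.mono' (continuous_gaussianDensity.comp
    (continuous_combine S a)).aestronglyMeasurable (ae_of_all _ fun y => ?_)
  rw [Real.norm_of_nonneg (gaussianDensity_pos hC _).le, gaussianDensity]
  refine mul_le_mul_of_nonneg_left (Real.exp_le_exp.2 ?_) (by positivity)
  have h1 := hkC (combine S a y - m)
  set mS : EuclideanSpace ℝ {i // i ∈ S} := WithLp.toLp 2 fun i => m i with hmS
  have h2 : combine S a y - m = combine S (a - mS) (y - mT) := by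
    ext i
    by_cases h : i ∈ S <;> simp [combine, h, hmS, hmT]
  have h3 : ‖y - mT‖ ^ 2 ≤ ‖combine S a y - m‖ ^ 2 := by
    rw [h2, norm_combine_sq]
    nlinarith [sq_nonneg ‖a - mS‖]
  nlinarith

theorem marginalDensity_pos (hC : C.PosDef) (a : EuclideanSpace ℝ {i // i ∈ S}) :
    0 < marginalDensity (gaussianDensity m C) S a := by
  unfold marginalDensity
  rw [integral_pos_iff_support_of_nonneg (fun y => (gaussianDensity_pos hC _).le)
    (integrable_gaussianDensity_combine S hC a)]
  have : Function.support (fun y => gaussianDensity m C (combine S a y)) = Set.univ :=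
    Set.eq_univ_of_forall fun y => (gaussianDensity_pos hC _).ne'
  rw [this]
  exact Measure.measure_univ_pos.2 (NeZero.ne _)

theorem condDensity_nonneg (hC : C.PosDef) (a : EuclideanSpace ℝ {i // i ∈ S})
    (y : EuclideanSpace ℝ {i // i ∉ S}) : 0 ≤ condDensity (gaussianDensity m C) S a y :=
  div_nonneg (gaussianDensity_pos hC _).le (marginalDensity_pos S hC a).le

theorem integrable_condDensity (hC : C.PosDef) (a : EuclideanSpace ℝ {i // i ∈ S}) :
    Integrable (condDensity (gaussianDensity m C) S a) :=
  (integrable_gaussianDensity_combine S hC a).div_const _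

theorem integral_condDensity (hC : C.PosDef) (a : EuclideanSpace ℝ {i // i ∈ S}) :
    ∫ y, condDensity (gaussianDensity m C) S a y = 1 := by
  unfold condDensity
  rw [integral_div]
  exact div_self (marginalDensity_pos S hC a).ne'

theorem isProbabilityMeasure_condDensity (hC : C.PosDef) (a : EuclideanSpace ℝ {i // i ∈ S}) :
    IsProbabilityMeasure ((volume : Measure (EuclideanSpace ℝ {i // i ∉ S})).withDensity
      fun y => ENNReal.ofReal (condDensity (gaussianDensity m C) S a y)) := by
  constructor
  rw [withDensity_apply _ MeasurableSet.univ, Measure.restrict_univ,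
    ← ofReal_integral_eq_lintegral_ofReal (integrable_condDensity S hC a)
      (ae_of_all _ (condDensity_nonneg S hC a)), integral_condDensity S hC a, ENNReal.ofReal_one]

/-- Translating the observed coordinates along a direction that is orthogonal to the unobserved
ones rescales the marginal density. -/
theorem marginalDensity_add (hC : C.PosDef) (a h : EuclideanSpace ℝ {i // i ∈ S})
    {w : EuclideanSpace ℝ {i // i ∉ S}}
    (hw : ∀ y, (C⁻¹ *ᵥ (combine S h w).ofLp) ⬝ᵥ (combine S 0 y).ofLp = 0) :
    marginalDensity (gaussianDensity m C) S (a + h) =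
      marginalDensity (gaussianDensity m C) S a *
        Real.exp (-((C⁻¹ *ᵥ (combine S h w).ofLp) ⬝ᵥ (combine S a 0 - m).ofLp) -
          (combine S h w).ofLp ⬝ᵥ (C⁻¹ *ᵥ (combine S h w).ofLp) / 2) := by
  unfold marginalDensity
  -- Translating y by w turns (a+h, y+w) into (a,y) + (h,w); orthogonality makes the exponential
  -- factor independent of y.
  rw [← integral_add_right_eq_self _ w, ← integral_mul_const]
  refine integral_congr_ae (ae_of_all _ fun y => ?_)
  have h1 : combine S a y - m = (combine S a 0 - m) + combine S 0 y := by
    rw [sub_add_eq_add_sub, ← combine_add, add_zero, zero_add]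
  simp only
  rw [combine_add, gaussianDensity_add hC, h1, WithLp.ofLp_add, dotProduct_add, hw, add_zero]

theorem tvDist_condDensity_le (hC : C.PosDef) (a a' : EuclideanSpace ℝ {i // i ∈ S}) :
    tvDist (condDensity (gaussianDensity m C) S a) (condDensity (gaussianDensity m C) S a') ≤
      ENNReal.ofReal (1 / 2 * √(lambdaMax C⁻¹ - lambdaMin C⁻¹) * ‖a - a'‖) := by
  obtain ⟨c, h, ha, ha', hn⟩ : ∃ c h : EuclideanSpace ℝ {i // i ∈ S},
      a = c + h ∧ a' = c + -h ∧ ‖a - a'‖ = 2 * ‖h‖ := by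
    refine ⟨(1 / 2 : ℝ) • (a + a'), (1 / 2 : ℝ) • (a - a'), by module, by module, ?_⟩
    rw [norm_smul, Real.norm_of_nonneg (by norm_num)]
    ring
  obtain ⟨w, hw⟩ := exists_combine_orthogonal S hC.inv h
  have hneg : ∀ y, combine S (-h) (-y) = -combine S h y := fun y => by
    simpa using combine_smul S (-1) h y
  have hw' : ∀ y, (C⁻¹ *ᵥ (combine S (-h) (-w)).ofLp) ⬝ᵥ (combine S 0 y).ofLp = 0 := fun y => by
    simp [hneg, mulVec_neg, hw]
  set q : EuclideanSpace ℝ (Fin d) → ℝ := fun u => u.ofLp ⬝ᵥ (C⁻¹ *ᵥ u.ofLp) with hq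
  have hqneg : ∀ u, q (-u) = q u := fun u => by simp [hq, mulVec_neg]
  set Z := marginalDensity (gaussianDensity m C) S c with hZ
  have hZ0 : 0 < Z := marginalDensity_pos S hC c
  have hadd : ∀ b y, combine S (c + b) y = combine S c y + combine S b 0 := fun b y => by
    rw [← combine_add, add_zero]
  have hmax := dotProduct_mulVec_le_lambdaMax hC.inv.isHermitian (combine S h 0)
  have hmin := lambdaMin_mul_norm_sq_le hC.inv.isHermitian (combine S h w)
  rw [norm_combine_sq] at hmax hmin
  -- The term in ‖w‖² can be dropped because λmin ≥ 0.
  have hmin' : lambdaMin C⁻¹ * ‖h‖ ^ 2 ≤ q (combine S h w) :=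
    le_trans (by nlinarith [lambdaMin_nonneg hC.inv, sq_nonneg ‖w‖]) hmin
  have hmax' : q (combine S h 0) ≤ lambdaMax C⁻¹ * ‖h‖ ^ 2 := by simpa using hmax
  have hs : 1 / 2 * √(lambdaMax C⁻¹ - lambdaMin C⁻¹) * ‖a - a'‖ =
      √(lambdaMax C⁻¹ - lambdaMin C⁻¹) * ‖a - a'‖ / 2 := by ring
  rw [hs]
  refine tvDist_le_of_affinity (h := fun y => gaussianDensity m C (combine S c y) *
      (Real.exp (-q (combine S h 0) / 2) / (Z * Real.exp (-q (combine S h w) / 2))))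
    (by positivity) (integrable_condDensity S hC a) (integrable_condDensity S hC a')
    ((integrable_gaussianDensity_combine S hC c).mul_const _) (condDensity_nonneg S hC a)
    (condDensity_nonneg S hC a') (fun y => ?_) (integral_condDensity S hC a)
    (integral_condDensity S hC a') ?_
  · have hneg0 := hneg 0
    rw [neg_zero] at hneg0
    unfold condDensity
    rw [ha, ha', marginalDensity_add S hC c h hw, marginalDensity_add S hC c (-h) hw', hadd, hadd,
      gaussianDensity_add hC, gaussianDensity_add hC, hneg, hneg0, ← hZ]
    change _ = (_ * Real.exp (_ - q (combine S h 0) / 2)) /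
      (_ * Real.exp (_ - q (combine S h w) / 2)) * ((_ * Real.exp (_ - q (-combine S h 0) / 2)) /
        (_ * Real.exp (_ - q (-combine S h w) / 2)))
    rw [hqneg, hqneg]
    simp only [WithLp.ofLp_neg, mulVec_neg, neg_dotProduct, neg_neg]
    generalize (C⁻¹ *ᵥ (combine S h 0).ofLp) ⬝ᵥ (combine S c y - m).ofLp = r
    generalize (C⁻¹ *ᵥ (combine S h w).ofLp) ⬝ᵥ (combine S c 0 - m).ofLp = t
    generalize q (combine S h 0) = q0
    generalize q (combine S h w) = q1
    have h0 : Real.exp (-q0 / 2) ^ 2 = Real.exp (-r - q0 / 2) * Real.exp (r - q0 / 2) := by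
      rw [sq, ← Real.exp_add, ← Real.exp_add]
      ring_nf
    have h1 : Real.exp (-q1 / 2) ^ 2 = Real.exp (-t - q1 / 2) * Real.exp (t - q1 / 2) := by
      rw [sq, ← Real.exp_add, ← Real.exp_add]
      ring_nf
    rw [mul_pow, div_pow, mul_pow, h0, h1, div_mul_div_comm]
    ring
  · rw [integral_mul_const]
    change _ ≤ Z * _
    have h1 : Z * (Real.exp (-q (combine S h 0) / 2) / (Z * Real.exp (-q (combine S h w) / 2))) =
        Real.exp (-(q (combine S h 0) - q (combine S h w)) / 2) := by
      rw [← mul_div_assoc, mul_div_mul_left _ _ hZ0.ne', ← Real.exp_sub]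
      ring_nf
    rw [h1]
    have h2 := Real.add_one_le_exp (-(q (combine S h 0) - q (combine S h w)) / 2)
    -- Only this inequality is needed, so λmin ≤ λmax never has to be shown.
    have h3 : lambdaMax C⁻¹ - lambdaMin C⁻¹ ≤ √(lambdaMax C⁻¹ - lambdaMin C⁻¹) ^ 2 := by
      rcases le_total 0 (lambdaMax C⁻¹ - lambdaMin C⁻¹) with h | h
      · rw [Real.sq_sqrt h]
      · exact h.trans (sq_nonneg _)
    have h4 := mul_le_mul_of_nonneg_right h3 (sq_nonneg ‖h‖)
    rw [hn]
    nlinarith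

end conditional

/-! ### The density of the multivariate Gaussian -/

section density

variable {d : ℕ}

theorem stdGaussian_eq_withDensity :
    stdGaussian (EuclideanSpace ℝ (Fin d)) = volume.withDensity fun x =>
      ENNReal.ofReal ((√((2 * Real.pi) ^ d))⁻¹ * Real.exp (-(1 / 2) * ‖x‖ ^ 2)) := by
  have hint : Integrable fun x : EuclideanSpace ℝ (Fin d) =>
      (√((2 * Real.pi) ^ d))⁻¹ * Real.exp (-(1 / 2) * ‖x‖ ^ 2) :=
    (integrable_exp_neg_mul_norm_sq (by norm_num)).const_mul _
  have : IsFiniteMeasure ((volume : Measure (EuclideanSpace ℝ (Fin d))).withDensity fun x =>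
      ENNReal.ofReal ((√((2 * Real.pi) ^ d))⁻¹ * Real.exp (-(1 / 2) * ‖x‖ ^ 2))) :=
    isFiniteMeasure_withDensity_ofReal hint.2
  refine Measure.ext_of_charFun ?_
  ext t
  rw [charFun_stdGaussian, charFun_apply,
    integral_withDensity_eq_integral_toReal_smul (by fun_prop)
      (ae_of_all _ fun _ => ENNReal.ofReal_lt_top)]
  have h1 : ∀ x : EuclideanSpace ℝ (Fin d),
      (ENNReal.ofReal ((√((2 * Real.pi) ^ d))⁻¹ * Real.exp (-(1 / 2) * ‖x‖ ^ 2))).toReal •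
        Complex.exp (inner ℝ x t * Complex.I) = ((√((2 * Real.pi) ^ d))⁻¹ : ℝ) *
          Complex.exp (-(1 / 2) * ‖x‖ ^ 2 + Complex.I * inner ℝ t x) := fun x => by
    rw [ENNReal.toReal_ofReal (by positivity), Complex.real_smul, Complex.exp_add,
      real_inner_comm, mul_comm Complex.I]
    push_cast
    ring
  simp_rw [h1]
  rw [integral_const_mul, GaussianFourier.integral_cexp_neg_mul_sq_norm_add (by norm_num)]
  have h2 : ((Real.pi : ℂ) / (1 / 2)) ^ (Module.finrank ℝ (EuclideanSpace ℝ (Fin d)) / 2 : ℂ) =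
      (√((2 * Real.pi) ^ d) : ℝ) := by
    have h3 : (Real.pi : ℂ) / (1 / 2) = ((2 * Real.pi : ℝ) : ℂ) := by push_cast; ring
    have h4 : (Module.finrank ℝ (EuclideanSpace ℝ (Fin d)) / 2 : ℂ) = ((d * (1 / 2) : ℝ) : ℂ) := by
      rw [finrank_euclideanSpace_fin]; push_cast; ring
    rw [h3, h4, ← Complex.ofReal_cpow (by positivity), Real.sqrt_eq_rpow,
      Real.rpow_mul (by positivity), Real.rpow_natCast]
  rw [h2, ← mul_assoc, ← Complex.ofReal_mul, inv_mul_cancel₀ (by positivity), Complex.ofReal_one,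
    one_mul, Complex.I_sq]
  congr 1
  ring

open scoped MatrixOrder in
theorem multivariateGaussian_eq_withDensity (m : EuclideanSpace ℝ (Fin d))
    {C : Matrix (Fin d) (Fin d) ℝ} (hC : C.PosDef) :
    multivariateGaussian m C = volume.withDensity
      fun x => ENNReal.ofReal (gaussianDensity m C x) := by
  set B := CFC.sqrt C with hB
  have hBB : B * B = C := CFC.sqrt_mul_sqrt_self _ hC.posSemidef.nonneg
  have hBt : Bᵀ = B := by
    have h : B.PosSemidef := nonneg_iff_posSemidef.1 (CFC.sqrt_nonneg C)
    simpa [IsHermitian] using h.isHermitian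
  have hdet : B.det * B.det = C.det := by rw [← det_mul, hBB]
  have hdet0 : B.det ≠ 0 := fun h => hC.det_pos.ne' (by rw [← hdet, h, zero_mul])
  have hBCB : B * C⁻¹ * B = 1 := by
    have h : IsUnit B.det := hdet0.isUnit
    rw [← hBB, Matrix.mul_inv_rev, ← mul_assoc, mul_nonsing_inv _ h, one_mul, nonsing_inv_mul _ h]
  -- B is the symmetric root of C, so BC⁻¹B = 1 turns the form of C⁻¹ at Lx into ‖x‖²; the Jacobian
  -- |det B| is √(det C).
  set L := toEuclideanCLM (𝕜 := ℝ) (n := Fin d) B with hL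
  have hLdet : LinearMap.det (L : EuclideanSpace ℝ (Fin d) →ₗ[ℝ] _) = B.det := by
    rw [hL, coe_toEuclideanCLM_eq_toEuclideanLin, toEuclideanLin_eq_toLin_orthonormal,
      LinearMap.det_toLin]
  have hmap : (volume : Measure (EuclideanSpace ℝ (Fin d))).map (fun x => m + L x) =
      ENNReal.ofReal |B.det⁻¹| • volume := by
    have h := Measure.map_linearMap_addHaar_eq_smul_addHaar
      (volume : Measure (EuclideanSpace ℝ (Fin d)))
      (f := (L : EuclideanSpace ℝ (Fin d) →ₗ[ℝ] _)) (by rwa [hLdet])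
    rw [hLdet] at h
    have h' : (fun x => m + L x) = (fun x => m + x) ∘ L := rfl
    rw [h', ← Measure.map_map (by fun_prop) (by fun_prop)]
    erw [h]
    rw [Measure.map_smul, map_add_left_eq_self]
  have hdens : ∀ x : EuclideanSpace ℝ (Fin d),
      (√((2 * Real.pi) ^ d))⁻¹ * Real.exp (-(1 / 2) * ‖x‖ ^ 2) =
        |B.det| * gaussianDensity m C (m + L x) := fun x => by
    have h1 : (L x).ofLp ⬝ᵥ (C⁻¹ *ᵥ (L x).ofLp) = ‖x‖ ^ 2 := by
      have h2 : (B *ᵥ x.ofLp) ⬝ᵥ (C⁻¹ *ᵥ B *ᵥ x.ofLp) = x.ofLp ⬝ᵥ ((B * C⁻¹ * B) *ᵥ x.ofLp) := by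
        rw [← mulVec_mulVec, ← mulVec_mulVec, dotProduct_mulVec x.ofLp B, ← mulVec_transpose, hBt]
      rw [hL, ofLp_toEuclideanCLM, h2, hBCB, one_mulVec, EuclideanSpace.real_norm_sq_eq]
      simp [dotProduct, sq]
    rw [gaussianDensity, add_sub_cancel_left, h1, ← hdet, Real.sqrt_mul (by positivity),
      Real.sqrt_mul_self_eq_abs]
    have := abs_pos.2 hdet0
    field_simp
  rw [multivariateGaussian, stdGaussian_eq_withDensity]
  refine Measure.ext fun s hs => ?_
  have hT : Measurable fun x => m + L x := by fun_prop
  rw [Measure.map_apply hT hs, withDensity_apply _ (hT hs), withDensity_apply _ hs]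
  have hg : Measurable fun x => ENNReal.ofReal (gaussianDensity m C x) :=
    continuous_gaussianDensity.measurable.ennreal_ofReal
  simp_rw [hdens, ENNReal.ofReal_mul (abs_nonneg B.det)]
  have hgT : Measurable fun x => ENNReal.ofReal (gaussianDensity m C (m + L x)) := hg.comp hT
  rw [lintegral_const_mul _ hgT, ← setLIntegral_map hs hg hT, hmap,
    Measure.restrict_smul, lintegral_smul_measure, smul_eq_mul, ← mul_assoc,
    ← ENNReal.ofReal_mul (abs_nonneg _), ← abs_mul, mul_inv_cancel₀ hdet0, abs_one,
    ENNReal.ofReal_one, one_mul]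

end density

end RemovalAttribution

theorem mainTheorem11 {d : ℕ} {Ω : Type*} [MeasurableSpace Ω] (P : Measure Ω)
    (X : Ω → EuclideanSpace ℝ (Fin d)) (m : EuclideanSpace ℝ (Fin d))
    (C : Matrix (Fin d) (Fin d) ℝ) (hC : C.PosDef)
    (hX : HasLaw X (multivariateGaussian m C) P) :
    P.map X = volume.withDensity
        (fun x => ENNReal.ofReal (RemovalAttribution.gaussianDensity m C x)) ∧
      RemovalAttribution.TVLipschitz (RemovalAttribution.gaussianDensity m C)
        (1 / 2 * √(RemovalAttribution.lambdaMax C⁻¹ - RemovalAttribution.lambdaMin C⁻¹)) :=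
  ⟨hX.map_eq.trans (RemovalAttribution.multivariateGaussian_eq_withDensity m hC),
    { nonneg_const := by positivity
      nonneg_cond := fun S => RemovalAttribution.condDensity_nonneg S hC
      isProbabilityMeasure_cond := fun S =>
        RemovalAttribution.isProbabilityMeasure_condDensity S hC
      tvDist_le := fun S => RemovalAttribution.tvDist_condDensity_le S hC }⟩
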